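/- **Theorem.** Let $\mu>0$, $\pi\in(0,1)$, $\nu=\frac{\pi\mu}{1-\pi}$, and let $X_1,X_2,\ldots$ be i.i.d. with the negative binomial distribution $\mathrm{NB}(\nu,\pi)$, i.e. $\mathbb P(X_i=x)=\binom{\nu+x-1}{x}(1-\pi)^x\pi^\nu$ for $x\in\mathbb N_0$; let $X$ denote a generic such variable, so that $\mathbb{E}[X]=\mu$, and put $\sigma^2=\mathbb V[X]$. Let $f:\mathbb N_0\to\mathbb R$ be such that $\mathbb E[f(X+1)^2]$, $\mathbb E[X^2f(X)^2]$, $\mathbb E[X^2f(X+1)^2]$ are finite, write $\tilde\mu_{klm}=\tilde\mu_f(k,l,m)=\mathbb E[X^k f(X)^l f(X+1)^m]$, and assume $\eta_2:=\tilde\mu_{101}-\mu\,\tilde\mu_{001}\neq0$. For $h:\mathbb N_0\to\mathbb R$ (or $\mathbb{R}^4$) let $\overline{h(X)}=\frac1n\sum_{i=1}^n h(X_i)$, let $\Delta f(x)=f(x+1)-f(x)$, and consider the Stein-MM estimator $$\hat\pi_n=\frac{\overline{X\,\Delta f(X)}}{\overline{X f(X+1)}-\overline X\;\overline{f(X+1)}}$$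 (with an arbitrary fixed convention, here the value $0$, if the denominator vanishes). Then the following hold. (1) $\hat\pi_n$ is asymptotically normal with mean $\pi$ and variance $\sigma^2_{f,\mathrm{NB}}=\sigma^2_{f,\mathrm{NB}}(n)$, i.e. $\sigma^2_{f,\mathrm{NB}}>0$ and $(\hat\pi_n-\pi)/\sigma_{f,\mathrm{NB}}\to \mathrm N(0,1)$ in distribution as $n\to\infty$, where $$\begin{aligned}\sigma^2_{f,\mathrm{NB}}=\frac1{\eta_2^4\,n}\Big[&\mu^2\Big(\tilde\mu_{001}\big(\tilde\mu_{001}(\tilde\mu_{202}-2\tilde\mu_{211}+\tilde\mu_{220})-2(\tilde\mu_{101}-\tilde\mu_{110})(\tilde\mu_{102}-\tilde\mu_{111})\big)+\tilde\mu_{002}(\tilde\mu_{101}-\tilde\mu_{110})^2\Big)\\ &-2\mu\Big(\tilde\mu_{001}^2(\tilde\mu_{101}-\tilde\mu_{110})(\tilde\mu_{201}-\tilde\mu_{210})\\ &\quad-\tilde\mu_{001}\big(\tilde\mu_{101}^3-2\tilde\mu_{101}^2\tilde\mu_{110}+\tilde\mu_{101}(\tilde\mu_{110}^2+\tilde\mu_{211}-\tilde\mu_{220})+\tilde\mu_{110}(\tilde\mu_{211}-\tilde\mu_{202})\big)\\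 &\quad+(\tilde\mu_{101}-\tilde\mu_{110})(\tilde\mu_{101}\tilde\mu_{111}-\tilde\mu_{102}\tilde\mu_{110})\Big)\\ &+\tilde\mu_{001}^2\sigma^2(\tilde\mu_{101}-\tilde\mu_{110})^2+\tilde\mu_{101}^2\tilde\mu_{220}-2\tilde\mu_{001}(\tilde\mu_{101}-\tilde\mu_{110})(\tilde\mu_{101}\tilde\mu_{210}-\tilde\mu_{110}\tilde\mu_{201})\\ &-2\tilde\mu_{101}\tilde\mu_{110}\tilde\mu_{211}+\tilde\mu_{110}^2\tilde\mu_{202}\Big].\end{aligned}$$ (2) The asymptotic bias of $\hat\pi_n$ is $$\begin{aligned}\mathbb B_{f,\mathrm{NB}}=-\frac1{\eta_2^3\,n}\Big[&\mu^2\big(\tilde\mu_{001}(\tilde\mu_{102}-\tilde\mu_{111})+\tilde\mu_{002}(\tilde\mu_{110}-\tilde\mu_{101})\big)\\ &+\mu\Big(\tilde\mu_{001}^2(\tilde\mu_{201}-\tilde\mu_{210})+\tilde\mu_{001}\big(\tilde\mu_{101}(\tilde\mu_{110}-\tilde\mu_{101})-\tilde\mu_{202}+\tilde\mu_{211}\big)\\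 &\quad+\tilde\mu_{101}(\tilde\mu_{102}+\tilde\mu_{111})-2\tilde\mu_{102}\tilde\mu_{110}\Big)\\ &+\tilde\mu_{110}\big(\tilde\mu_{001}^2\sigma^2-2\tilde\mu_{001}\tilde\mu_{201}+\tilde\mu_{202}\big)+\tilde\mu_{001}\tilde\mu_{101}\big(-\tilde\mu_{001}\sigma^2+\tilde\mu_{201}+\tilde\mu_{210}\big)\\ &-\tilde\mu_{101}^3+\tilde\mu_{101}^2\tilde\mu_{110}-\tilde\mu_{101}\tilde\mu_{211}\Big].\end{aligned}$$ Here "asymptotic bias" refers to the second-order Taylor approximation: let $Z(x)=(x,\,f(x+1),\,x f(x),\,x f(x+1))^\top$, $\mu_Z=\mathbb E[Z(X)]$, $g(z)=\frac{z_4-z_3}{z_4-z_1z_2}$ (so that $\hat\pi_n=g(\overline{Z(X)})$), let $D$ and $H$ be the gradient and the Hessian of $g$ at $\mu_Z$, and $Q_n=D^\top(\overline{Z(X)}-\mu_Z)+\frac12(\overline{Z(X)}-\mu_Z)^\top H(\overline{Z(X)}-\mu_Z)$. Then $n(\hat\pi_n-\pi-Q_n)\to0$ in probability, and for every $n\ge1$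 the variable $Q_n$ is integrable with $\mathbb E[Q_n]=\mathbb B_{f,\mathrm{NB}}$. -/

import Mathlib

open MeasureTheory ProbabilityTheory Filter Topology

/-- Probability mass function of the negative binomial distribution `NB(ν, q)`:
`P(X = x) = binom(ν + x - 1, x) (1 - q)^x q^ν` with the generalized binomial coefficient. -/
noncomputable def nbPmf (ν q : ℝ) (x : ℕ) : ℝ :=
  Ring.choose (ν + x - 1) x * (1 - q) ^ x * q ^ ν

/-- The negative binomial distribution `NB(ν, q)` as a measure on `ℕ`. -/
noncomputable def nbMeasure (ν q : ℝ) : Measure ℕ :=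
  Measure.sum fun x : ℕ => ENNReal.ofReal (nbPmf ν q x) • Measure.dirac x

theorem nbPmf_nonneg {ν q : ℝ} (hν : 0 < ν) (hq : q ∈ Set.Ioo (0 : ℝ) 1) (x : ℕ) :
    0 ≤ nbPmf ν q x := by
  have h1 : 0 ≤ Ring.choose (ν + x - 1) x := by
    have h := Ring.factorial_nsmul_multichoose_eq_ascPochhammer ν x
    rw [Ring.multichoose_eq, Polynomial.ascPochhammer_smeval_eq_eval, nsmul_eq_mul] at h
    have h2 : 0 < (ascPochhammer ℝ x).eval ν := ascPochhammer_pos x ν hν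
    have h3 : (0 : ℝ) < (x.factorial : ℝ) := by positivity
    rw [← h] at h2
    exact (pos_of_mul_pos_right h2 h3.le).le
  have h2 : (0 : ℝ) ≤ 1 - q := by linarith [hq.2]
  exact mul_nonneg (mul_nonneg h1 (pow_nonneg h2 x)) (Real.rpow_nonneg hq.1.le ν)

theorem nbPmf_hasSum {ν q : ℝ} (hq : q ∈ Set.Ioo (0 : ℝ) 1) :
    HasSum (nbPmf ν q) 1 := by
  have h := (Real.one_div_one_sub_rpow_hasFPowerSeriesOnBall_zero ν).hasSum (y := 1 - q) (by
    have : |1 - q| < 1 := by rw [abs_lt]; constructor <;> linarith [hq.1, hq.2]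
    simpa [enorm_eq_nnnorm, ← NNReal.coe_lt_coe] using this)
  have h2 := h.mul_right (q ^ ν)
  have h3 : (0 : ℝ) < q ^ ν := Real.rpow_pos_of_pos hq.1 ν
  simp only [zero_add, sub_sub_cancel, one_div, inv_mul_cancel₀ h3.ne'] at h2
  have h4 : nbPmf ν q = fun x => (FormalMultilinearSeries.ofScalars ℝ
      (fun n : ℕ => Ring.choose (ν + n - 1) n) x fun _ => 1 - q) * q ^ ν := by
    funext x
    simp [nbPmf, FormalMultilinearSeries.ofScalars]
  rw [h4]
  exact h2

/-- `NB(ν, q)` is a probability measure. -/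
theorem isProbabilityMeasure_nbMeasure {ν q : ℝ} (hν : 0 < ν) (hq : q ∈ Set.Ioo (0 : ℝ) 1) :
    IsProbabilityMeasure (nbMeasure ν q) := by
  constructor
  have h := nbPmf_hasSum (ν := ν) hq
  rw [nbMeasure, Measure.sum_apply _ MeasurableSet.univ]
  simp only [Measure.smul_apply, measure_univ, smul_eq_mul, mul_one]
  rw [← ENNReal.ofReal_tsum_of_nonneg (nbPmf_nonneg hν hq) h.summable, h.tsum_eq,
    ENNReal.ofReal_one]

/-- The mixed moments `E[X^k f(X)^l f(X+1)^m]` for `X` with distribution `ρ`. -/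
noncomputable def mixedMoment (ρ : Measure ℕ) (f : ℕ → ℝ) (k l m : ℕ) : ℝ :=
  ∫ x, (x : ℝ) ^ k * f x ^ l * f (x + 1) ^ m ∂ρ

/-- Sample mean of `h(X)` over the first `n` observations. -/
noncomputable def sampleMean {Ω : Type*} (X : ℕ → Ω → ℕ) (h : ℕ → ℝ) (n : ℕ) (ω : Ω) : ℝ :=
  (∑ i ∈ Finset.range n, h (X i ω)) / n

/-- The Stein-MM estimator of the second parameter of the negative binomial distribution,
from the first `n` observations. -/
noncomputable def steinEstimator {Ω : Type*} (f : ℕ → ℝ) (X : ℕ → Ω → ℕ) (n : ℕ) (ω : Ω) : ℝ :=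
  sampleMean X (fun x => x * (f (x + 1) - f x)) n ω /
    (sampleMean X (fun x => x * f (x + 1)) n ω -
      sampleMean X (fun x => (x : ℝ)) n ω * sampleMean X (fun x => f (x + 1)) n ω)

/-- The vector `(x, f(x+1), x f(x), x f(x+1))`. -/
def steinVec (f : ℕ → ℝ) (x : ℕ) : Fin 4 → ℝ :=
  ![x, f (x + 1), x * f x, x * f (x + 1)]

/-- `g(x₁, x₂, x₃, x₄) = (x₄ - x₃) / (x₄ - x₁ x₂)`; the estimator is `g` evaluated at the sample
mean of `steinVec f`. -/
noncomputable def steinG (z : Fin 4 → ℝ) : ℝ :=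
  (z 3 - z 2) / (z 3 - z 0 * z 1)

/-- The non-constant part of the second-order Taylor polynomial of `g` at `a` in the
increment `h`: gradient term plus one half of the Hessian term. -/
noncomputable def taylorTwo {E : Type*} [NormedAddCommGroup E] [NormedSpace ℝ E]
    (g : E → ℝ) (a h : E) : ℝ :=
  fderiv ℝ g a h + 1 / 2 * fderiv ℝ (fderiv ℝ g) a h h

/-- `T n` is asymptotically normal with mean `θ` and variance `s2 n`: the variances are
eventually positive and `(T n - θ) / √(s2 n)` converges in distribution to `N(0, 1)`. -/
def IsAsymptoticallyNormal {Ω : Type*} [MeasurableSpace Ω] (P : Measure Ω)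
    [IsProbabilityMeasure P] (T : ℕ → Ω → ℝ) (θ : ℝ) (s2 : ℕ → ℝ) : Prop :=
  (∀ᶠ n in atTop, 0 < s2 n) ∧
    TendstoInDistribution (fun n ω => (T n ω - θ) / √(s2 n)) atTop id (fun _ => P)
      (gaussianReal 0 1)

/-- `B n` is the asymptotic (second-order) bias of `T n` as an estimator of `θ`, where `T n` is
the function `g` of a statistic `W n` that concentrates at `a`: the second-order Taylor
approximation of `T n - θ` is correct up to an error `o_P(1/n)`, and its expectation is `B n`. -/
def IsAsymptoticBias {Ω E : Type*} [MeasurableSpace Ω] [NormedAddCommGroup E] [NormedSpace ℝ E]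
    (P : Measure Ω) (T : ℕ → Ω → ℝ) (θ : ℝ) (g : E → ℝ) (W : ℕ → Ω → E) (a : E)
    (B : ℕ → ℝ) : Prop :=
  TendstoInMeasure P
      (fun (n : ℕ) ω => (n : ℝ) * (T n ω - θ - taylorTwo g a (W n ω - a))) atTop (fun _ => 0) ∧
    ∀ n : ℕ, 1 ≤ n →
      Integrable (fun ω => taylorTwo g a (W n ω - a)) P ∧
        ∫ ω, taylorTwo g a (W n ω - a) ∂P = B n

/-- `η₂ = μ̃(1,0,1) - μ μ̃(0,0,1)`, where `M k l m` stands for `μ̃(k,l,m)`. -/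
def etaTwo (μ : ℝ) (M : ℕ → ℕ → ℕ → ℝ) : ℝ :=
  M 1 0 1 - μ * M 0 0 1

/-- The asymptotic variance for sample size `n`, in terms of the mean `μ`, the variance `s2`
of the observations and the mixed moments `M k l m`. -/
noncomputable def steinAsympVar (μ s2 : ℝ) (M : ℕ → ℕ → ℕ → ℝ) (n : ℕ) : ℝ :=
  1 / (etaTwo μ M ^ 4 * n) *
    (μ ^ 2 * (M 0 0 1 * (M 0 0 1 * (M 2 0 2 - 2 * M 2 1 1 + M 2 2 0)
          - 2 * (M 1 0 1 - M 1 1 0) * (M 1 0 2 - M 1 1 1))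
        + M 0 0 2 * (M 1 0 1 - M 1 1 0) ^ 2)
      - 2 * μ * (M 0 0 1 ^ 2 * (M 1 0 1 - M 1 1 0) * (M 2 0 1 - M 2 1 0)
        - M 0 0 1 * (M 1 0 1 ^ 3 - 2 * M 1 0 1 ^ 2 * M 1 1 0
            + M 1 0 1 * (M 1 1 0 ^ 2 + M 2 1 1 - M 2 2 0)
            + M 1 1 0 * (M 2 1 1 - M 2 0 2))
        + (M 1 0 1 - M 1 1 0) * (M 1 0 1 * M 1 1 1 - M 1 0 2 * M 1 1 0))
      + M 0 0 1 ^ 2 * s2 * (M 1 0 1 - M 1 1 0) ^ 2 + M 1 0 1 ^ 2 * M 2 2 0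
      - 2 * M 0 0 1 * (M 1 0 1 - M 1 1 0) * (M 1 0 1 * M 2 1 0 - M 1 1 0 * M 2 0 1)
      - 2 * M 1 0 1 * M 1 1 0 * M 2 1 1 + M 1 1 0 ^ 2 * M 2 0 2)

/-- The asymptotic bias for sample size `n`, in terms of the mean `μ`, the variance `s2`
of the observations and the mixed moments `M k l m`. -/
noncomputable def steinAsympBias (μ s2 : ℝ) (M : ℕ → ℕ → ℕ → ℝ) (n : ℕ) : ℝ :=
  -(1 / (etaTwo μ M ^ 3 * n)) *
    (μ ^ 2 * (M 0 0 1 * (M 1 0 2 - M 1 1 1) + M 0 0 2 * (M 1 1 0 - M 1 0 1))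
      + μ * (M 0 0 1 ^ 2 * (M 2 0 1 - M 2 1 0)
        + M 0 0 1 * (M 1 0 1 * (M 1 1 0 - M 1 0 1) - M 2 0 2 + M 2 1 1)
        + M 1 0 1 * (M 1 0 2 + M 1 1 1) - 2 * M 1 0 2 * M 1 1 0)
      + M 1 1 0 * (M 0 0 1 ^ 2 * s2 - 2 * M 0 0 1 * M 2 0 1 + M 2 0 2)
      + M 0 0 1 * M 1 0 1 * (-M 0 0 1 * s2 + M 2 0 1 + M 2 1 0)
      - M 1 0 1 ^ 3 + M 1 0 1 ^ 2 * M 1 1 0 - M 1 0 1 * M 2 1 1)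

/-! Write `q` for π, `Z` for `steinVec f` and `a` for its mean. The Stein identity `E[X f(X)] = (1 -
q) E[(ν + X) f(X+1)]`, with `(1 - q) ν = q μ`, rearranges to `steinG a = q`, so the claim is a delta
method for `steinG` at `a`, a smooth point because `η₂ ≠ 0`.

Let `h` be the centred sample mean of `Z`. Since `E‖h‖² = O(1/n)`, Markov's inequality kills `n`
times an `o(‖h‖²)` remainder (bias) and `√n` times an `O(‖h‖²)` remainder (normality); see
`tendstoInMeasure_sampleMean_remainder`. The gradient term is the sample mean of one scalar
function, so the scalar central limit theorem and Slutsky's lemma suffice. Variance and bias are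
contractions of the covariance matrix of `Z` with the gradient and with half the Hessian; the closed
formulas are then polynomial identities after clearing powers of `η₂`.

The limit is nondegenerate (`variance_steinGrad_ne_zero`): zero variance makes the linearized
statistic constant on all of `ℕ`, a recursion that forces `f` to be constant on `x ≥ 1`, whence `η₂
= 0`. -/

/-! ### Negative binomial law: recursion, second moment, Stein identity. -/

theorem ringChoose_add_natCast_eq (ν : ℝ) (x : ℕ) :
    (x.factorial : ℝ) * Ring.choose (ν + x - 1) x = (ascPochhammer ℝ x).eval ν := by
  have h := Ring.factorial_nsmul_multichoose_eq_ascPochhammer ν x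
  rwa [Ring.multichoose_eq, Polynomial.ascPochhammer_smeval_eq_eval, nsmul_eq_mul] at h

/-- The Panjer recursion for the negative binomial probabilities. -/
theorem nbPmf_succ (ν q : ℝ) (x : ℕ) :
    ((x + 1 : ℕ) : ℝ) * nbPmf ν q (x + 1) = (1 - q) * (ν + x) * nbPmf ν q x := by
  have h1 := ringChoose_add_natCast_eq ν (x + 1)
  have h0 := ringChoose_add_natCast_eq ν x
  rw [ascPochhammer_succ_eval, ← h0, Nat.factorial_succ] at h1
  have hx : (x.factorial : ℝ) ≠ 0 := by positivity
  have h2 : ((x + 1 : ℕ) : ℝ) * Ring.choose (ν + (x + 1 : ℕ) - 1) (x + 1)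
      = (ν + x) * Ring.choose (ν + x - 1) x := by
    apply mul_left_cancel₀ hx
    push_cast at h1 ⊢
    linear_combination h1
  rw [nbPmf, nbPmf, pow_succ]
  linear_combination (1 - q) ^ x * (1 - q) * q ^ ν * h2

theorem nbPmf_pos {ν q : ℝ} (hν : 0 < ν) (hq : q ∈ Set.Ioo (0 : ℝ) 1) (x : ℕ) :
    0 < nbPmf ν q x := by
  have h1 : 0 < (1 - q) := by linarith [hq.2]
  induction x with
  | zero => simpa [nbPmf] using Real.rpow_pos_of_pos hq.1 ν
  | succ x ih =>
    have h := nbPmf_succ ν q x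
    have h2 : 0 < (1 - q) * (ν + x) * nbPmf ν q x := by positivity
    rw [← h] at h2
    exact pos_of_mul_pos_right h2 (by positivity)

theorem nbMeasure_eq_withDensity (ν q : ℝ) :
    nbMeasure ν q = Measure.count.withDensity fun x => ENNReal.ofReal (nbPmf ν q x) := by
  ext s hs
  rw [nbMeasure, Measure.sum_apply _ hs, withDensity_apply _ hs, ← lintegral_indicator hs,
    lintegral_count]
  refine tsum_congr fun x => ?_
  by_cases hx : x ∈ s <;> simp [hx, Measure.dirac_apply' _ hs]

theorem integrable_nbMeasure_iff {ν q : ℝ} (hν : 0 < ν) (hq : q ∈ Set.Ioo (0 : ℝ) 1)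
    (h : ℕ → ℝ) :
    Integrable h (nbMeasure ν q) ↔ Summable fun x => nbPmf ν q x * h x := by
  rw [nbMeasure_eq_withDensity, integrable_withDensity_iff_integrable_smul' (by fun_prop)
    (ae_of_all _ fun _ => ENNReal.ofReal_lt_top), integrable_count_iff]
  simp only [ENNReal.toReal_ofReal (nbPmf_nonneg hν hq _), smul_eq_mul]
  exact summable_norm_iff

theorem integral_nbMeasure {ν q : ℝ} (hν : 0 < ν) (hq : q ∈ Set.Ioo (0 : ℝ) 1)
    {h : ℕ → ℝ} (hh : Integrable h (nbMeasure ν q)) :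
    ∫ x, h x ∂nbMeasure ν q = ∑' x, nbPmf ν q x * h x := by
  have h1 := hasSum_integral_measure (f := h) hh
  rw [nbMeasure, ← h1.tsum_eq]
  refine tsum_congr fun x => ?_
  rw [integral_smul_measure, integral_dirac, ENNReal.toReal_ofReal (nbPmf_nonneg hν hq _),
    smul_eq_mul]

/-- Every atom has positive mass. This lets the nondegeneracy argument evaluate an almost sure
identity at each integer. -/
theorem ae_nbMeasure_iff {ν q : ℝ} (hν : 0 < ν) (hq : q ∈ Set.Ioo (0 : ℝ) 1) (p : ℕ → Prop) :
    (∀ᵐ x ∂nbMeasure ν q, p x) ↔ ∀ x, p x := by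
  refine ⟨fun h x => ?_, fun h => ae_of_all _ h⟩
  rw [nbMeasure, Measure.ae_sum_iff' (MeasurableSet.of_discrete)] at h
  have hx := h x
  rw [Measure.ae_ennreal_smul_measure_iff (by simpa using nbPmf_pos hν hq x)] at hx
  simpa using hx

theorem integrable_sq_nbMeasure {ν q : ℝ} (hν : 0 < ν) (hq : q ∈ Set.Ioo (0 : ℝ) 1) :
    Integrable (fun x : ℕ => (x : ℝ) ^ 2) (nbMeasure ν q) := by
  -- Ratio test: by the recursion, successive quotients tend to `1 - q < 1`. The shift removes the
  -- vanishing term at `x = 0`, which would be a zero denominator.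
  rw [integrable_nbMeasure_iff hν hq, ← summable_nat_add_iff 1]
  have hp := nbPmf_pos hν hq
  refine summable_of_ratio_test_tendsto_lt_one (l := 1 - q) (by linarith [hq.1])
    (Eventually.of_forall fun x => ?_) ?_
  · have := hp (x + 1)
    positivity
  have key : ∀ x : ℕ, ‖nbPmf ν q (x + 1 + 1) * ((x + 1 + 1 : ℕ) : ℝ) ^ 2‖ /
      ‖nbPmf ν q (x + 1) * ((x + 1 : ℕ) : ℝ) ^ 2‖
      = (1 - q) * (1 + ν / ((x : ℝ) + 1)) * (1 + 1 / ((x : ℝ) + 1)) := by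
    intro x
    have h1 := hp (x + 1)
    have h2 := hp (x + 1 + 1)
    have h3 := nbPmf_succ ν q (x + 1)
    rw [Real.norm_of_nonneg (by positivity), Real.norm_of_nonneg (by positivity),
      div_eq_iff (by positivity)]
    have h4 : nbPmf ν q (x + 1 + 1) * ((x + 1 + 1 : ℕ) : ℝ) ^ 2
        = ((x + 1 + 1 : ℕ) : ℝ) * ((1 - q) * (ν + (x + 1 : ℕ)) * nbPmf ν q (x + 1)) := by
      rw [← h3]; ring
    rw [h4]
    push_cast
    field_simp
    ring
  simp_rw [key]
  have t1 : Tendsto (fun x : ℕ => 1 / ((x : ℝ) + 1)) atTop (𝓝 0) :=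
    tendsto_one_div_add_atTop_nhds_zero_nat
  have t2 := ((t1.const_mul ν).const_add 1).const_mul (1 - q)
  have t3 := t2.mul (t1.const_add 1)
  simpa [div_eq_mul_inv] using t3

/-- The Stein identity of the negative binomial distribution. -/
theorem stein_identity_nbMeasure {ν q : ℝ} (hν : 0 < ν) (hq : q ∈ Set.Ioo (0 : ℝ) 1) {f : ℕ → ℝ}
    (h1 : Integrable (fun x : ℕ => x * f x) (nbMeasure ν q)) :
    ∫ x, x * f x ∂nbMeasure ν q = (1 - q) * ∫ x, (ν + x) * f (x + 1) ∂nbMeasure ν q := by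
  have hs := (integrable_nbMeasure_iff hν hq _).1 h1
  have hq' : (1 - q) ≠ 0 := by linarith [hq.2]
  have key : ∀ x : ℕ, nbPmf ν q (x + 1) * (((x + 1 : ℕ) : ℝ) * f (x + 1)) =
      (1 - q) * (nbPmf ν q x * ((ν + x) * f (x + 1))) := fun x => by
    linear_combination f (x + 1) * nbPmf_succ ν q x
  have hs' := (summable_nat_add_iff 1).2 hs
  simp_rw [key] at hs'
  -- Integrability of the right-hand side is inherited from the left through the termwise identity
  -- `key`. The index shift loses nothing, as the term at `x = 0` is zero.
  have hs'' := (summable_mul_left_iff hq').1 hs'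
  rw [integral_nbMeasure hν hq h1, hs.tsum_eq_zero_add,
    integral_nbMeasure hν hq ((integrable_nbMeasure_iff hν hq _).2 hs''), ← tsum_mul_left]
  simp_rw [key]
  simp

/-! ### Moments and central limit theorem for sample means. -/

section SampleMean

variable {Ω : Type*} [MeasurableSpace Ω] {P : Measure Ω} {ρ : Measure ℕ} {X : ℕ → Ω → ℕ}

theorem measurable_sampleMean (hX : ∀ i, Measurable (X i)) (h : ℕ → ℝ) (n : ℕ) :
    Measurable (sampleMean X h n) :=
  (Finset.measurable_sum _ fun i _ => (Measurable.of_discrete (f := h)).comp (hX i)).div_const _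

theorem memLp_comp_of_map_eq {p : ENNReal} (hX : ∀ i, Measurable (X i))
    (hlaw : ∀ i, P.map (X i) = ρ) {h : ℕ → ℝ} (hh : MemLp h p ρ) (i : ℕ) :
    MemLp (fun ω => h (X i ω)) p P := by
  rw [← hlaw i] at hh
  exact hh.comp_of_map (hX i).aemeasurable

theorem memLp_sampleMean {p : ENNReal} (hX : ∀ i, Measurable (X i)) (hlaw : ∀ i, P.map (X i) = ρ)
    {h : ℕ → ℝ} (hh : MemLp h p ρ) (n : ℕ) : MemLp (sampleMean X h n) p P := by
  have := (memLp_finsetSum (Finset.range n)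
    fun i _ => memLp_comp_of_map_eq hX hlaw hh i).mul_const ((n : ℝ)⁻¹)
  simp only [← div_eq_mul_inv] at this
  exact this

theorem integral_comp_of_map_eq (hX : ∀ i, Measurable (X i)) (hlaw : ∀ i, P.map (X i) = ρ)
    (h : ℕ → ℝ) (i : ℕ) : ∫ ω, h (X i ω) ∂P = ∫ x, h x ∂ρ := by
  rw [← hlaw i, integral_map (hX i).aemeasurable
    (Measurable.of_discrete (f := h)).aestronglyMeasurable]

theorem integral_sampleMean (hX : ∀ i, Measurable (X i)) (hlaw : ∀ i, P.map (X i) = ρ)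
    {h : ℕ → ℝ} (hh : Integrable h ρ) {n : ℕ} (hn : 1 ≤ n) :
    ∫ ω, sampleMean X h n ω ∂P = ∫ x, h x ∂ρ := by
  have hn' : (n : ℝ) ≠ 0 := by positivity
  simp only [sampleMean]
  rw [integral_div, integral_finsetSum _ fun i _ => memLp_one_iff_integrable.1
    (memLp_comp_of_map_eq hX hlaw (memLp_one_iff_integrable.2 hh) i)]
  simp only [integral_comp_of_map_eq hX hlaw h, Finset.sum_const, Finset.card_range, nsmul_eq_mul]
  field_simp

/-- Independence leaves only the `n` diagonal terms among the `n²` covariances. -/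
theorem covariance_sampleMean [IsProbabilityMeasure P] (hX : ∀ i, Measurable (X i))
    (hindep : iIndepFun X P) (hlaw : ∀ i, P.map (X i) = ρ) {h k : ℕ → ℝ} (hh : MemLp h 2 ρ)
    (hk : MemLp k 2 ρ) {n : ℕ} (hn : 1 ≤ n) :
    cov[sampleMean X h n, sampleMean X k n; P] = cov[h, k; ρ] / n := by
  have hn' : (n : ℝ) ≠ 0 := by positivity
  have hmeas : ∀ g : ℕ → ℝ, Measurable g := fun g => Measurable.of_discrete
  have hL := fun i => memLp_comp_of_map_eq hX hlaw hh i
  have kL := fun i => memLp_comp_of_map_eq hX hlaw hk i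
  have hij : ∀ i j, cov[fun ω => h (X i ω), fun ω => k (X j ω); P]
      = if i = j then cov[h, k; ρ] else 0 := by
    intro i j
    split_ifs with hc
    · subst hc
      rw [← hlaw i, covariance_map_fun (hmeas h).aestronglyMeasurable
        (hmeas k).aestronglyMeasurable (hX i).aemeasurable]
    · exact ((hindep.indepFun hc).comp (hmeas h) (hmeas k)).covariance_eq_zero (hL i) (kL j)
  have e : ∀ g : ℕ → ℝ, sampleMean X g n
      = fun ω => (∑ i ∈ Finset.range n, g (X i ω)) / (n : ℝ) := fun g => rfl
  rw [e h, e k, covariance_fun_div_left, covariance_fun_div_right,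
    covariance_fun_sum_fun_sum' (fun i _ => hL i) (fun i _ => kL i)]
  have hsum : ∑ i ∈ Finset.range n, ∑ j ∈ Finset.range n, (if i = j then cov[h, k; ρ] else 0)
      = n * cov[h, k; ρ] := by
    rw [Finset.sum_congr rfl fun i hi => by rw [Finset.sum_ite_eq, if_pos hi]]
    simp
  simp only [hij, hsum]
  field_simp

/-- The central limit theorem for sample means. -/
theorem tendstoInDistribution_sampleMean [IsProbabilityMeasure P] (hX : ∀ i, Measurable (X i))
    (hindep : iIndepFun X P) (hlaw : ∀ i, P.map (X i) = ρ) {h : ℕ → ℝ} (hh : MemLp h 2 ρ)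
    (hv : Var[h; ρ] ≠ 0) :
    TendstoInDistribution
      (fun (n : ℕ) ω => √n * (sampleMean X h n ω - ∫ x, h x ∂ρ) / √(Var[h; ρ])) atTop id
      (fun _ => P) (gaussianReal 0 1) := by
  have hρ : IsProbabilityMeasure ρ := by
    rw [← hlaw 0]; exact Measure.isProbabilityMeasure_map (hX 0).aemeasurable
  set m := ∫ x, h x ∂ρ with hm
  set v := Var[h; ρ] with hvdef
  have hv0 : 0 ≤ v := variance_nonneg _ _
  have hmeas : Measurable fun x => (h x - m) / √v := Measurable.of_discrete
  have hhm : Measurable h := Measurable.of_discrete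
  have hclt := tendstoInDistribution_inv_sqrt_mul_sum (P := P) (P' := gaussianReal 0 1) (Y := id)
    (X := fun i ω => (h (X i ω) - m) / √v) HasLaw.id ?_ ?_
    (hindep.comp (fun _ x => (h x - m) / √v) fun _ => hmeas)
    (fun i => (IdentDistrib.mk (hX i).aemeasurable (hX 0).aemeasurable
      ((hlaw i).trans (hlaw 0).symm)).comp hmeas)
  · convert hclt using 3 with n ω
    rcases Nat.eq_zero_or_pos n with rfl | hn
    · simp
    have hn0 : (0 : ℝ) < n := by exact_mod_cast hn
    have hs : √(n : ℝ) ≠ 0 := (Real.sqrt_pos.2 hn0).ne'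
    rw [← Finset.sum_div, Finset.sum_sub_distrib, sampleMean]
    simp only [Finset.sum_const, Finset.card_range, nsmul_eq_mul]
    have : (n : ℝ) = √n * √n := (Real.mul_self_sqrt hn0.le).symm
    rw [← mul_div_assoc]
    congr 1
    rw [eq_inv_mul_iff_mul_eq₀ hs, ← mul_assoc, ← this]
    field_simp
  · rw [integral_comp_of_map_eq hX hlaw (fun x => (h x - m) / √v) 0, integral_div,
      integral_sub (hh.integrable (by norm_num)) (integrable_const _)]
    simp [hm]
  · simp only [Pi.pow_apply]
    rw [integral_comp_of_map_eq hX hlaw (fun x => ((h x - m) / √v) ^ 2) 0]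
    simp only [div_pow]
    rw [integral_div, Real.sq_sqrt hv0, ← variance_eq_integral hhm.aemeasurable, div_self hv]

end SampleMean

/-! ### A Markov criterion for negligible remainders. -/

/-- If `n * E[S n]` is bounded and `R n` is at most an arbitrarily small multiple of `n * S n` on
an event `S n ≤ δ`, then `R n` tends to zero in probability. -/
theorem tendstoInMeasure_zero_of_le_mul {Ω : Type*} [MeasurableSpace Ω] {P : Measure Ω}
    [IsProbabilityMeasure P] {S R : ℕ → Ω → ℝ} {K : ℝ} (hS0 : ∀ n ω, 0 ≤ S n ω)
    (hSi : ∀ n, Integrable (S n) P) (hSK : ∀ n : ℕ, 1 ≤ n → ∫ ω, S n ω ∂P ≤ K / n)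
    (hR : ∀ c > 0, ∃ δ > 0, ∀ᶠ n : ℕ in atTop, ∀ ω, S n ω ≤ δ → |R n ω| ≤ c * (n * S n ω)) :
    TendstoInMeasure P R atTop (fun _ => 0) := by
  have hK : 0 ≤ K := by
    have := (integral_nonneg (hS0 1)).trans (hSK 1 le_rfl)
    simpa using this
  rw [tendstoInMeasure_iff_measureReal_dist]
  intro ε hε
  rw [Metric.tendsto_atTop']
  intro e he
  -- With this constant `c` the second Markov bound below equals `K / (K + 1) * (e / 2)`; using `K +
  -- 1` allows `K = 0`.
  obtain ⟨δ, hδ, hc⟩ := hR (ε * e / (2 * (K + 1))) (by positivity)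
  set c := ε * e / (2 * (K + 1)) with hcdef
  have hc0 : 0 < c := by positivity
  have hlim : Tendsto (fun n : ℕ => K / δ / (n : ℝ)) atTop (𝓝 0) :=
    tendsto_const_div_atTop_nhds_zero_nat _
  obtain ⟨N, hN⟩ := ((hc.and (hlim.eventually (gt_mem_nhds (half_pos he)))).and
    (eventually_ge_atTop 1)).exists_forall_of_atTop
  refine ⟨N, fun n hn => ?_⟩
  obtain ⟨⟨hn1, hn2⟩, hn3⟩ := hN n hn.le
  have hn0 : (0 : ℝ) < n := by exact_mod_cast hn3
  -- Where `S n < δ`, a large remainder gives `ε ≤ |R n| ≤ c n S n`, so `S n` is at least `ε / (c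
  -- n)`.
  have hsub : {ω | ε ≤ dist (R n ω) 0} ⊆ {ω | δ ≤ S n ω} ∪ {ω | ε / (c * n) ≤ S n ω} := by
    intro ω hω
    by_cases h : δ ≤ S n ω
    · exact Or.inl h
    · right
      have h1 := hn1 ω (not_le.1 h).le
      simp only [Set.mem_ofPred_eq, Real.dist_eq, sub_zero] at hω ⊢
      rw [div_le_iff₀ (by positivity)]
      linarith
  have markov : ∀ t > 0, P.real {ω | t ≤ S n ω} ≤ K / n / t := fun t ht => by
    rw [le_div_iff₀ ht, mul_comm]
    exact (mul_meas_ge_le_integral_of_nonneg (ae_of_all _ (hS0 n)) (hSi n) t).trans (hSK n hn3)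
  rw [Real.dist_eq, sub_zero, abs_of_nonneg measureReal_nonneg]
  calc P.real {ω | ε ≤ dist (R n ω) 0}
      ≤ P.real ({ω | δ ≤ S n ω} ∪ {ω | ε / (c * n) ≤ S n ω}) := measureReal_mono hsub
    _ ≤ P.real {ω | δ ≤ S n ω} + P.real {ω | ε / (c * n) ≤ S n ω} := measureReal_union_le _ _
    _ ≤ K / n / δ + K / n / (ε / (c * n)) :=
        add_le_add (markov _ hδ) (markov _ (by positivity))
    _ = K / δ / n + K / (K + 1) * (e / 2) := by
        rw [hcdef]; field_simp
    _ < e / 2 + 1 * (e / 2) := by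
        refine add_lt_add_of_lt_of_le hn2 ?_
        gcongr
        rw [div_le_one (by positivity)]
        linarith
    _ = e := by ring

/-! ### Taylor expansion of `steinG`. -/

theorem hasFDerivAt_steinG {z : Fin 4 → ℝ} (hz : z 3 - z 0 * z 1 ≠ 0) :
    ∃ L : (Fin 4 → ℝ) →L[ℝ] ℝ, HasFDerivAt steinG L z ∧ ∀ h, L h =
      (h 3 - h 2) * (z 3 - z 0 * z 1)⁻¹ -
        (z 3 - z 2) * (h 3 - z 0 * h 1 - z 1 * h 0) * ((z 3 - z 0 * z 1)⁻¹) ^ 2 := by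
  have p : ∀ i : Fin 4, HasFDerivAt (fun z : Fin 4 → ℝ => z i)
      (ContinuousLinearMap.proj (R := ℝ) i) z := fun i => hasFDerivAt_apply i z
  have hB := (p 3).fun_sub ((p 0).mul (p 1))
  have hA := (p 3).fun_sub (p 2)
  have h := hA.mul ((hasDerivAt_inv hz).comp_hasFDerivAt z hB)
  refine ⟨_, h.congr_of_eventuallyEq (Eventually.of_forall fun z => div_eq_mul_inv _ _),
    fun h => ?_⟩
  simp
  ring

/-- With `q = steinG a`, `B = a 3 - a 0 * a 1`, `β = h 3 - a 0 * h 1 - a 1 * h 0` and `u = h 3 - h 2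
- q β`, one has exactly `steinG (a + h) - q = (u + q h₀h₁) / (B + β - h₀h₁)` wherever the
denominator is nonzero. The formula collects the terms of order at most two. -/
theorem taylorTwo_steinG {a : Fin 4 → ℝ} (ha : a 3 - a 0 * a 1 ≠ 0) (h : Fin 4 → ℝ) :
    taylorTwo steinG a h =
      (h 3 - h 2 - steinG a * (h 3 - a 0 * h 1 - a 1 * h 0)) / (a 3 - a 0 * a 1)
      + steinG a * (h 0 * h 1) / (a 3 - a 0 * a 1)
      - (h 3 - h 2 - steinG a * (h 3 - a 0 * h 1 - a 1 * h 0)) * (h 3 - a 0 * h 1 - a 1 * h 0)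
        / (a 3 - a 0 * a 1) ^ 2 := by
  have hc : ContDiffAt ℝ 2 steinG a := by
    unfold steinG
    exact ContDiffAt.div (by fun_prop) (by fun_prop) ha
  have hd : DifferentiableAt ℝ (fderiv ℝ steinG) a :=
    (hc.fderiv_right (m := 1) (by norm_num)).differentiableAt (by norm_num)
  have hev : ∀ᶠ z : Fin 4 → ℝ in 𝓝 a, z 3 - z 0 * z 1 ≠ 0 :=
    (by fun_prop : ContinuousAt (fun z : Fin 4 → ℝ => z 3 - z 0 * z 1) a).eventually_ne ha
  have hfd : ∀ z : Fin 4 → ℝ, z 3 - z 0 * z 1 ≠ 0 → fderiv ℝ steinG z h =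
      (h 3 - h 2) * (z 3 - z 0 * z 1)⁻¹ -
        (z 3 - z 2) * (h 3 - z 0 * h 1 - z 1 * h 0) * ((z 3 - z 0 * z 1)⁻¹) ^ 2 := by
    intro z hz
    obtain ⟨L, hL, hL'⟩ := hasFDerivAt_steinG hz
    rw [hL.fderiv, hL']
  -- Freezing the direction `h` reduces the Hessian form to the derivative of a scalar function.
  have h2 : fderiv ℝ (fderiv ℝ steinG) a h h = fderiv ℝ (fun z => fderiv ℝ steinG z h) a h := by
    rw [fderiv_clm_apply hd (differentiableAt_const h)]
    simp
  have h3 : (fun z => fderiv ℝ steinG z h) =ᶠ[𝓝 a] fun z => (h 3 - h 2) * (z 3 - z 0 * z 1)⁻¹ -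
        (z 3 - z 2) * (h 3 - z 0 * h 1 - z 1 * h 0) * ((z 3 - z 0 * z 1)⁻¹) ^ 2 :=
    hev.mono hfd
  have p : ∀ i : Fin 4, HasFDerivAt (fun z : Fin 4 → ℝ => z i)
      (ContinuousLinearMap.proj (R := ℝ) i) a := fun i => hasFDerivAt_apply i a
  have hB := (hasDerivAt_inv ha).comp_hasFDerivAt a ((p 3).fun_sub ((p 0).mul (p 1)))
  have hb := ((p 0).mul_const (h 1)).const_sub (h 3) |>.fun_sub ((p 1).mul_const (h 0))
  have hA := (p 3).fun_sub (p 2)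
  have hφ := (hB.const_mul (h 3 - h 2)).fun_sub ((hA.mul hb).mul (hB.pow 2))
  have h4 := hφ.congr_of_eventuallyEq (h3.trans (Eventually.of_forall fun z => by simp))
  rw [taylorTwo, h2, hfd a ha, h4.fderiv]
  simp [steinG]
  field_simp
  ring

theorem steinG_taylor_isLittleO {a : Fin 4 → ℝ} (ha : a 3 - a 0 * a 1 ≠ 0) :
    (fun h => steinG (a + h) - steinG a - taylorTwo steinG a h) =o[𝓝 0] fun h => ‖h‖ ^ 2 := by
  set q := steinG a with hq
  set B := a 3 - a 0 * a 1 with hB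
  have hh : ∀ i : Fin 4, (fun h : Fin 4 → ℝ => h i) =O[𝓝 0] fun h => ‖h‖ := fun i =>
    Asymptotics.IsBigO.of_bound 1 (Eventually.of_forall fun h => by
      simpa using norm_le_pi_norm h i)
  have hone : (fun h : Fin 4 → ℝ => ‖h‖) =o[𝓝 0] fun _ => (1 : ℝ) :=
    (Asymptotics.isLittleO_one_iff ℝ).2 tendsto_norm_zero
  have hβ : (fun h : Fin 4 → ℝ => h 3 - a 0 * h 1 - a 1 * h 0) =O[𝓝 0] fun h => ‖h‖ :=
    ((hh 3).sub ((hh 1).const_mul_left _)).sub ((hh 0).const_mul_left _)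
  have hu : (fun h : Fin 4 → ℝ => h 3 - h 2 - q * (h 3 - a 0 * h 1 - a 1 * h 0))
      =O[𝓝 0] fun h => ‖h‖ := ((hh 3).sub (hh 2)).sub (hβ.const_mul_left _)
  have h01 : (fun h : Fin 4 → ℝ => h 0 * h 1) =O[𝓝 0] fun h => ‖h‖ * ‖h‖ := (hh 0).mul (hh 1)
  have h01' : (fun h : Fin 4 → ℝ => h 0 * h 1) =O[𝓝 0] fun h => ‖h‖ :=
    h01.trans (by simpa using (Asymptotics.isBigO_refl _ _).mul hone.isBigO)
  have hB' : Tendsto (fun h : Fin 4 → ℝ => (a + h) 3 - (a + h) 0 * (a + h) 1) (𝓝 0) (𝓝 B) := by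
    have : Continuous (fun h : Fin 4 → ℝ => (a + h) 3 - (a + h) 0 * (a + h) 1) := by fun_prop
    simpa using this.tendsto 0
  have hinv : (fun h : Fin 4 → ℝ => ((a + h) 3 - (a + h) 0 * (a + h) 1)⁻¹) =O[𝓝 0]
      fun _ => (1 : ℝ) := (hB'.inv₀ ha).isBigO_one ℝ
  -- This is the Taylor remainder times `B²` times the perturbed denominator: the terms `± B u β`
  -- cancel, so everything left has order at least three. The inverse of the perturbed denominator
  -- stays bounded near `0`.
  have hN : (fun h : Fin 4 → ℝ => B * ((h 3 - h 2 - q * (h 3 - a 0 * h 1 - a 1 * h 0)) * (h 0 * h 1)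
        + q * ((h 0 * h 1) * (h 0 * h 1 - (h 3 - a 0 * h 1 - a 1 * h 0))))
        - ((h 3 - h 2 - q * (h 3 - a 0 * h 1 - a 1 * h 0)) * (h 3 - a 0 * h 1 - a 1 * h 0))
          * (h 0 * h 1 - (h 3 - a 0 * h 1 - a 1 * h 0)))
      =O[𝓝 0] fun h => ‖h‖ * (‖h‖ * ‖h‖) := by
    refine (((hu.mul h01).add (((h01.mul (h01'.sub hβ)).congr_right
      fun h => mul_assoc _ _ _).const_mul_left q)).const_mul_left B).sub ?_
    exact ((hu.mul hβ).mul (h01'.sub hβ)).congr_right fun h => mul_assoc _ _ _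
  have hN' := (hN.mul hinv).trans_isLittleO
    (show (fun h : Fin 4 → ℝ => ‖h‖ * (‖h‖ * ‖h‖) * 1) =o[𝓝 0] fun h => ‖h‖ ^ 2 by
      simpa [pow_two] using hone.mul_isBigO (Asymptotics.isBigO_refl (fun h : Fin 4 → ℝ => ‖h‖ * ‖h‖) (𝓝 0)))
  refine (hN'.const_mul_left (B⁻¹ ^ 2)).congr' ?_ EventuallyEq.rfl
  filter_upwards [hB'.eventually_ne ha] with h hne
  rw [taylorTwo_steinG ha, ← hq, ← hB]
  have hA : a 3 - a 2 = q * B := by rw [hq, steinG, ← hB, div_mul_cancel₀ _ ha]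
  have hB1 : (a + h) 3 - (a + h) 0 * (a + h) 1
      = B + (h 3 - a 0 * h 1 - a 1 * h 0) - h 0 * h 1 := by
    simp only [Pi.add_apply, hB]; ring
  have hA1 : (a + h) 3 - (a + h) 2 = q * B + (h 3 - h 2) := by
    simp only [Pi.add_apply, ← hA]; ring
  rw [steinG, hA1]
  generalize (a + h) 3 - (a + h) 0 * (a + h) 1 = C at hne hB1 ⊢
  generalize h 3 - a 0 * h 1 - a 1 * h 0 = β at hB1 ⊢
  field_simp
  rw [hB1]
  ring

/-! ### Delta method for centred sample means. -/

/-- The norm on `ι → ℝ` is the supremum norm; the sum of squares dominating it has an expectation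
expressed by variances. -/
theorem norm_sq_le_sum_sq {ι : Type*} [Fintype ι] (h : ι → ℝ) : ‖h‖ ^ 2 ≤ ∑ j, h j ^ 2 := by
  rw [← Real.le_sqrt (norm_nonneg h) (Finset.sum_nonneg fun j _ => sq_nonneg _)]
  refine (pi_norm_le_iff_of_nonneg (Real.sqrt_nonneg _)).2 fun j => ?_
  rw [Real.norm_eq_abs]
  exact Real.abs_le_sqrt (Finset.single_le_sum (f := fun j => h j ^ 2)
    (fun j _ => sq_nonneg _) (Finset.mem_univ j))

/-- Turns the gradient term into a scalar sample mean, so that no multivariate limit theorem is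
needed. -/
theorem sampleMean_sum_mul {Ω ι : Type*} [Fintype ι] {X : ℕ → Ω → ℕ} {Z : ι → ℕ → ℝ} (w : ι → ℝ) (n : ℕ) (ω : Ω) :
    sampleMean X (fun x => ∑ j, w j * Z j x) n ω = ∑ j, w j * sampleMean X (Z j) n ω := by
  simp only [sampleMean, mul_div_assoc', Finset.mul_sum]
  rw [Finset.sum_comm, Finset.sum_div]

theorem variance_sum_mul {ι : Type*} [Fintype ι] {ρ : Measure ℕ} {Z : ι → ℕ → ℝ} [IsFiniteMeasure ρ]
    (hZ : ∀ j, MemLp (Z j) 2 ρ) (w : ι → ℝ) :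
    Var[fun x => ∑ j, w j * Z j x; ρ] = ∑ i, ∑ j, w i * w j * cov[Z i, Z j; ρ] := by
  rw [variance_fun_sum fun j => (hZ j).const_mul (w j)]
  refine Finset.sum_congr rfl fun i _ => Finset.sum_congr rfl fun j _ => ?_
  rw [covariance_const_mul_left, covariance_const_mul_right, mul_assoc]

section Delta

variable {Ω ι : Type*} [MeasurableSpace Ω] {P : Measure Ω} [IsProbabilityMeasure P]
  {ρ : Measure ℕ} {X : ℕ → Ω → ℕ} {Z : ι → ℕ → ℝ}

theorem integral_mul_sampleMean_sub (hX : ∀ i, Measurable (X i)) (hindep : iIndepFun X P)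
    (hlaw : ∀ i, P.map (X i) = ρ) (hZ : ∀ j, MemLp (Z j) 2 ρ) (i j : ι) {n : ℕ} (hn : 1 ≤ n) :
    ∫ ω, (sampleMean X (Z i) n ω - ∫ x, Z i x ∂ρ) * (sampleMean X (Z j) n ω - ∫ x, Z j x ∂ρ) ∂P
      = cov[Z i, Z j; ρ] / n := by
  have hρ : IsProbabilityMeasure ρ := by
    rw [← hlaw 0]; exact Measure.isProbabilityMeasure_map (hX 0).aemeasurable
  have hi := fun j => (hZ j).integrable (by norm_num)
  rw [← covariance_sampleMean hX hindep hlaw (hZ i) (hZ j) hn, covariance,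
    integral_sampleMean hX hlaw (hi i) hn, integral_sampleMean hX hlaw (hi j) hn]

theorem memLp_sampleMean_sub (hX : ∀ i, Measurable (X i))
    (hlaw : ∀ i, P.map (X i) = ρ) (hZ : ∀ j, MemLp (Z j) 2 ρ) (j : ι) (n : ℕ) :
    MemLp (fun ω => sampleMean X (Z j) n ω - ∫ x, Z j x ∂ρ) 2 P :=
  (memLp_sampleMean hX hlaw (hZ j) n).sub (memLp_const _)

variable [Fintype ι]

/-- Common frame for both scalings, `n` with `o(‖h‖²)` and `√n` with `O(‖h‖²)`: each is eventually
below any small multiple of `n ‖h‖²`, whose mean is bounded. -/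
theorem tendstoInMeasure_sampleMean_remainder (hX : ∀ i, Measurable (X i))
    (hindep : iIndepFun X P) (hlaw : ∀ i, P.map (X i) = ρ) (hZ : ∀ j, MemLp (Z j) 2 ρ)
    {b : ℕ → ℝ} {r : (ι → ℝ) → ℝ}
    (hr : ∀ c > 0, ∀ᶠ p : ℕ × (ι → ℝ) in atTop ×ˢ 𝓝 0,
      |b p.1 * r p.2| ≤ c * (p.1 * ‖p.2‖ ^ 2)) :
    TendstoInMeasure P
      (fun n ω => b n * r fun j => sampleMean X (Z j) n ω - ∫ x, Z j x ∂ρ) atTop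
      (fun _ => 0) := by
  have hsq := fun n j => (memLp_sampleMean_sub hX hlaw hZ j n).integrable_sq
  refine tendstoInMeasure_zero_of_le_mul
    (S := fun n ω => ∑ j, (sampleMean X (Z j) n ω - ∫ x, Z j x ∂ρ) ^ 2)
    (K := ∑ j, cov[Z j, Z j; ρ])
    (fun n ω => Finset.sum_nonneg fun j _ => sq_nonneg _)
    (fun n => integrable_finsetSum _ fun j _ => hsq n j) (fun n hn => ?_) fun c hc => ?_
  · rw [integral_finsetSum _ fun j _ => hsq n j, Finset.sum_div]
    refine Finset.sum_le_sum fun j _ => ?_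
    simp only [sq]
    exact (integral_mul_sampleMean_sub hX hindep hlaw hZ j j hn).le
  · obtain ⟨p, hp, p', hp', hpp⟩ := eventually_prod_iff.1 (hr c hc)
    obtain ⟨δ, hδ, hδ'⟩ := Metric.eventually_nhds_iff.1 hp'
    -- Half of `δ` turns the non-strict bound on the sum of squares into the strict bound `‖h‖ < δ`.
    refine ⟨(δ / 2) ^ 2, by positivity, hp.mono fun n hn ω hω => ?_⟩
    have hle := norm_sq_le_sum_sq fun j => sampleMean X (Z j) n ω - ∫ x, Z j x ∂ρ
    have hlt : ‖fun j => sampleMean X (Z j) n ω - ∫ x, Z j x ∂ρ‖ < δ := by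
      have := (sq_le_sq₀ (norm_nonneg _) (by positivity)).1 (hle.trans hω)
      linarith
    refine (hpp hn (hδ' (by rwa [dist_zero_right]))).trans ?_
    dsimp only
    gcongr

theorem tendstoInMeasure_mul_of_isLittleO (hX : ∀ i, Measurable (X i))
    (hindep : iIndepFun X P) (hlaw : ∀ i, P.map (X i) = ρ) (hZ : ∀ j, MemLp (Z j) 2 ρ)
    {r : (ι → ℝ) → ℝ} (hr : r =o[𝓝 0] fun h => ‖h‖ ^ 2) :
    TendstoInMeasure P
      (fun (n : ℕ) ω => (n : ℝ) * r fun j => sampleMean X (Z j) n ω - ∫ x, Z j x ∂ρ) atTop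
      (fun _ => 0) := by
  refine tendstoInMeasure_sampleMean_remainder hX hindep hlaw hZ (b := fun n => n)
    fun c hc => ?_
  filter_upwards [(hr.def hc).prod_inr atTop] with p hp
  rw [abs_mul, Nat.abs_cast, mul_left_comm]
  rw [Real.norm_eq_abs, norm_pow, norm_norm] at hp
  gcongr

theorem tendstoInMeasure_sqrt_mul_of_isBigO (hX : ∀ i, Measurable (X i))
    (hindep : iIndepFun X P) (hlaw : ∀ i, P.map (X i) = ρ) (hZ : ∀ j, MemLp (Z j) 2 ρ)
    {r : (ι → ℝ) → ℝ} (hr : r =O[𝓝 0] fun h => ‖h‖ ^ 2) :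
    TendstoInMeasure P
      (fun (n : ℕ) ω => √n * r fun j => sampleMean X (Z j) n ω - ∫ x, Z j x ∂ρ) atTop
      (fun _ => 0) := by
  obtain ⟨C, hC⟩ := hr.bound
  refine tendstoInMeasure_sampleMean_remainder hX hindep hlaw hZ (b := fun n => √n)
    fun c hc => ?_
  -- Beyond this point `C ≤ c √n`, hence `√n * C ≤ c * n`.
  have hn : ∀ᶠ n : ℕ in atTop, C / c ≤ √(n : ℝ) :=
    (Real.tendsto_sqrt_atTop.comp tendsto_natCast_atTop_atTop).eventually_ge_atTop _
  filter_upwards [hC.prod_inr atTop, hn.prod_inl (𝓝 0)] with p hp hp'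
  rw [Real.norm_eq_abs, norm_pow, norm_norm] at hp
  rw [div_le_iff₀ hc] at hp'
  rw [abs_mul, abs_of_nonneg (Real.sqrt_nonneg _)]
  calc √(p.1 : ℝ) * |r p.2| ≤ √(p.1 : ℝ) * (√(p.1 : ℝ) * c * ‖p.2‖ ^ 2) := by
        gcongr
        exact hp.trans (by gcongr)
    _ = c * (√(p.1 : ℝ) * √(p.1 : ℝ) * ‖p.2‖ ^ 2) := by ring
    _ = c * (p.1 * ‖p.2‖ ^ 2) := by rw [Real.mul_self_sqrt (Nat.cast_nonneg _)]

theorem integrable_quadratic_sampleMean (hX : ∀ i, Measurable (X i))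
    (hlaw : ∀ i, P.map (X i) = ρ) (hZ : ∀ j, MemLp (Z j) 2 ρ) (w : ι → ℝ) (c : ι → ι → ℝ)
    (n : ℕ) {h : Ω → ι → ℝ} (hh : ∀ ω j, h ω j = sampleMean X (Z j) n ω - ∫ x, Z j x ∂ρ) :
    Integrable (fun ω => ∑ j, w j * h ω j) P ∧
      Integrable (fun ω => ∑ i, ∑ j, c i j * (h ω i * h ω j)) P := by
  have hL := fun j => memLp_sampleMean_sub hX hlaw hZ j n
  simp only [hh]
  exact ⟨integrable_finsetSum _ fun j _ => ((hL j).integrable (by norm_num)).const_mul _,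
    integrable_finsetSum _ fun i _ => integrable_finsetSum _ fun j _ =>
      ((hL i).integrable_mul (hL j)).const_mul _⟩

/-- The expectation of a quadratic polynomial of centred sample means. -/
theorem integral_quadratic_sampleMean (hX : ∀ i, Measurable (X i)) (hindep : iIndepFun X P)
    (hlaw : ∀ i, P.map (X i) = ρ) (hZ : ∀ j, MemLp (Z j) 2 ρ) (w : ι → ℝ) (c : ι → ι → ℝ)
    {n : ℕ} (hn : 1 ≤ n) {h : Ω → ι → ℝ}
    (hh : ∀ ω j, h ω j = sampleMean X (Z j) n ω - ∫ x, Z j x ∂ρ) :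
    ∫ ω, (∑ j, w j * h ω j + ∑ i, ∑ j, c i j * (h ω i * h ω j)) ∂P
      = ∑ i, ∑ j, c i j * (cov[Z i, Z j; ρ] / n) := by
  have hρ : IsProbabilityMeasure ρ := by
    rw [← hlaw 0]; exact Measure.isProbabilityMeasure_map (hX 0).aemeasurable
  obtain ⟨i1, i2⟩ := integrable_quadratic_sampleMean hX hlaw hZ w c n hh
  have hL := fun j => memLp_sampleMean_sub hX hlaw hZ j n
  have hp : ∀ i j, Integrable (fun ω => c i j * ((sampleMean X (Z i) n ω - ∫ x, Z i x ∂ρ)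
      * (sampleMean X (Z j) n ω - ∫ x, Z j x ∂ρ))) P := fun i j =>
    ((hL i).integrable_mul (hL j)).const_mul _
  rw [integral_add i1 i2]
  simp only [hh]
  rw [integral_finsetSum _ fun j _ => ((hL j).integrable (by norm_num)).const_mul _,
    integral_finsetSum _ fun i _ => integrable_finsetSum _ fun j _ => hp i j]
  have h1 : ∀ j, ∫ ω, w j * (sampleMean X (Z j) n ω - ∫ x, Z j x ∂ρ) ∂P = 0 := fun j => by
    rw [integral_const_mul, integral_sub ((memLp_sampleMean hX hlaw (hZ j) n).integrable
      (by norm_num)) (integrable_const _),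
      integral_sampleMean hX hlaw ((hZ j).integrable (by norm_num)) hn]
    simp
  simp only [h1, Finset.sum_const_zero, zero_add]
  refine Finset.sum_congr rfl fun i _ => ?_
  rw [integral_finsetSum _ fun j _ => hp i j]
  refine Finset.sum_congr rfl fun j _ => ?_
  rw [integral_const_mul, integral_mul_sampleMean_sub hX hindep hlaw hZ i j hn]

end Delta

/-! ### Coordinates of the gradient and of the quadratic term. -/

/-- The gradient of `steinG` at `a`, up to the factor `1 / (a 3 - a 0 * a 1)`. -/
noncomputable def steinNum (a : Fin 4 → ℝ) : Fin 4 → ℝ :=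
  ![steinG a * a 1, steinG a * a 0, -1, 1 - steinG a]

/-- The gradient of `steinG` at `a`. -/
noncomputable def steinGrad (a : Fin 4 → ℝ) (j : Fin 4) : ℝ :=
  steinNum a j / (a 3 - a 0 * a 1)

/-- A (nonsymmetric) matrix of one half of the Hessian form of `steinG` at `a`. -/
noncomputable def steinQuad (a : Fin 4 → ℝ) (i j : Fin 4) : ℝ :=
  steinG a * (![1, 0, 0, 0] i * ![0, 1, 0, 0] j) / (a 3 - a 0 * a 1)
    - steinNum a i * ![-a 1, -a 0, 0, 1] j / (a 3 - a 0 * a 1) ^ 2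

/-- The quadratic form is evaluated only at `(h, h)`, so its coefficient matrix need not be
symmetric; contraction with a symmetric covariance matrix does not notice the difference. -/
theorem taylorTwo_steinG_eq_sum {a : Fin 4 → ℝ} (ha : a 3 - a 0 * a 1 ≠ 0) (h : Fin 4 → ℝ) :
    taylorTwo steinG a h
      = ∑ j, steinGrad a j * h j + ∑ i, ∑ j, steinQuad a i j * (h i * h j) := by
  rw [taylorTwo_steinG ha]
  simp only [Fin.sum_univ_four, steinGrad, steinQuad, steinNum, Matrix.cons_val]
  ring

/-- The first-order remainder is the second-order one, `o(‖h‖²)`, plus a quadratic form. -/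
theorem steinG_linear_remainder_isBigO {a : Fin 4 → ℝ} (ha : a 3 - a 0 * a 1 ≠ 0) :
    (fun h => steinG (a + h) - steinG a - ∑ j, steinGrad a j * h j) =O[𝓝 0]
      fun h => ‖h‖ ^ 2 := by
  have hh : ∀ i : Fin 4, (fun h : Fin 4 → ℝ => h i) =O[𝓝 0] fun h => ‖h‖ := fun i =>
    Asymptotics.IsBigO.of_bound 1 (Eventually.of_forall fun h => by
      simpa using norm_le_pi_norm h i)
  have hq : (fun h : Fin 4 → ℝ => ∑ i, ∑ j, steinQuad a i j * (h i * h j)) =O[𝓝 0]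
      fun h => ‖h‖ ^ 2 := by
    refine Asymptotics.IsBigO.fun_sum fun i _ => ?_
    refine Asymptotics.IsBigO.fun_sum fun j _ => ?_
    simpa only [sq] using ((hh i).mul (hh j)).const_mul_left (steinQuad a i j)
  refine ((steinG_taylor_isLittleO ha).isBigO.add hq).congr_left fun h => ?_
  rw [taylorTwo_steinG_eq_sum ha]
  ring

/-! ### Mean and covariance of `steinVec` in mixed moments. -/

section Moments

variable {ρ : Measure ℕ} {f : ℕ → ℝ}

theorem memLp_steinVec (hx : Integrable (fun x : ℕ => (x : ℝ) ^ 2) ρ)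
    (h002 : Integrable (fun x : ℕ => f (x + 1) ^ 2) ρ)
    (h220 : Integrable (fun x : ℕ => (x : ℝ) ^ 2 * f x ^ 2) ρ)
    (h202 : Integrable (fun x : ℕ => (x : ℝ) ^ 2 * f (x + 1) ^ 2) ρ) (j : Fin 4) :
    MemLp (fun x => steinVec f x j) 2 ρ := by
  rw [memLp_two_iff_integrable_sq Measurable.of_discrete.aestronglyMeasurable]
  fin_cases j
  · simpa [steinVec] using hx
  · simpa [steinVec] using h002
  · simpa [steinVec, mul_pow] using h220
  · simpa [steinVec, mul_pow] using h202

theorem integral_steinVec (f : ℕ → ℝ) (ρ : Measure ℕ) :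
    ∫ x, steinVec f x 0 ∂ρ = ∫ x : ℕ, (x : ℝ) ∂ρ ∧
    ∫ x, steinVec f x 1 ∂ρ = mixedMoment ρ f 0 0 1 ∧
    ∫ x, steinVec f x 2 ∂ρ = mixedMoment ρ f 1 1 0 ∧
    ∫ x, steinVec f x 3 ∂ρ = mixedMoment ρ f 1 0 1 := by
  simp [steinVec, mixedMoment]

theorem covariance_steinVec [IsProbabilityMeasure ρ]
    (hZ : ∀ j, MemLp (fun x => steinVec f x j) 2 ρ) (i j : Fin 4) {k l m : ℕ}
    (h : ∀ x, steinVec f x i * steinVec f x j = (x : ℝ) ^ k * f x ^ l * f (x + 1) ^ m) :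
    cov[fun x => steinVec f x i, fun x => steinVec f x j; ρ]
      = mixedMoment ρ f k l m - (∫ x, steinVec f x i ∂ρ) * ∫ x, steinVec f x j ∂ρ := by
  rw [covariance_eq_sub (hZ i) (hZ j), mixedMoment]
  simp only [Pi.mul_apply, h]

/-- The covariance matrix of `steinVec f`. -/
noncomputable def steinCov (μ s2 : ℝ) (M : ℕ → ℕ → ℕ → ℝ) : Fin 4 → Fin 4 → ℝ :=
  ![![s2, M 1 0 1 - μ * M 0 0 1, M 2 1 0 - μ * M 1 1 0, M 2 0 1 - μ * M 1 0 1],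
    ![M 1 0 1 - μ * M 0 0 1, M 0 0 2 - M 0 0 1 * M 0 0 1, M 1 1 1 - M 0 0 1 * M 1 1 0,
      M 1 0 2 - M 0 0 1 * M 1 0 1],
    ![M 2 1 0 - μ * M 1 1 0, M 1 1 1 - M 0 0 1 * M 1 1 0, M 2 2 0 - M 1 1 0 * M 1 1 0,
      M 2 1 1 - M 1 1 0 * M 1 0 1],
    ![M 2 0 1 - μ * M 1 0 1, M 1 0 2 - M 0 0 1 * M 1 0 1, M 2 1 1 - M 1 1 0 * M 1 0 1,
      M 2 0 2 - M 1 0 1 * M 1 0 1]]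

theorem covariance_steinVec_eq_steinCov [IsProbabilityMeasure ρ]
    (hZ : ∀ j, MemLp (fun x => steinVec f x j) 2 ρ) (i j : Fin 4) :
    cov[fun x => steinVec f x i, fun x => steinVec f x j; ρ]
      = steinCov (∫ x : ℕ, (x : ℝ) ∂ρ) (Var[fun x : ℕ => (x : ℝ); ρ]) (mixedMoment ρ f) i j := by
  obtain ⟨e0, e1, e2, e3⟩ := integral_steinVec f ρ
  have h00 : cov[fun x => steinVec f x 0, fun x => steinVec f x 0; ρ]
      = Var[fun x : ℕ => (x : ℝ); ρ] :=
    covariance_self (X := fun x : ℕ => (x : ℝ)) Measurable.of_discrete.aemeasurable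
  have h01 := covariance_steinVec hZ 0 1 (k := 1) (l := 0) (m := 1)
    fun x => by simp [steinVec]
  have h02 := covariance_steinVec hZ 0 2 (k := 2) (l := 1) (m := 0)
    fun x => by simp [steinVec]; ring
  have h03 := covariance_steinVec hZ 0 3 (k := 2) (l := 0) (m := 1)
    fun x => by simp [steinVec]; ring
  have h11 := covariance_steinVec hZ 1 1 (k := 0) (l := 0) (m := 2)
    fun x => by simp [steinVec]; ring
  have h12 := covariance_steinVec hZ 1 2 (k := 1) (l := 1) (m := 1)
    fun x => by simp [steinVec]; ring
  have h13 := covariance_steinVec hZ 1 3 (k := 1) (l := 0) (m := 2)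
    fun x => by simp [steinVec]; ring
  have h22 := covariance_steinVec hZ 2 2 (k := 2) (l := 2) (m := 0)
    fun x => by simp [steinVec]; ring
  have h23 := covariance_steinVec hZ 2 3 (k := 2) (l := 1) (m := 1)
    fun x => by simp [steinVec]; ring
  have h33 := covariance_steinVec hZ 3 3 (k := 2) (l := 0) (m := 2)
    fun x => by simp [steinVec]; ring
  simp only [e0, e1, e2, e3] at h01 h02 h03 h11 h12 h13 h22 h23 h33
  fin_cases i <;> fin_cases j
  · exact h00
  · exact h01
  · exact h02
  · exact h03
  · exact (covariance_comm _ _).trans h01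
  · exact h11
  · exact h12
  · exact h13
  · exact (covariance_comm _ _).trans h02
  · exact (covariance_comm _ _).trans h12
  · exact h22
  · exact h23
  · exact (covariance_comm _ _).trans h03
  · exact (covariance_comm _ _).trans h13
  · exact (covariance_comm _ _).trans h23
  · exact h33

end Moments

/-! ### Matching the closed formulas for variance and bias. -/

/-- `steinNum` still contains `steinG a`, a fraction over `η₂`. Multiplying it by `η₂` makes it
polynomial, so the quadratic form acquires the single denominator `η₂ ^ 4` and the numerators agree
by `ring`. -/
theorem steinAsympVar_eq_sum {μ s2 : ℝ} {M : ℕ → ℕ → ℕ → ℝ} (hη : etaTwo μ M ≠ 0)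
    {a : Fin 4 → ℝ} (h0 : a 0 = μ) (h1 : a 1 = M 0 0 1) (h2 : a 2 = M 1 1 0)
    (h3 : a 3 = M 1 0 1) (n : ℕ) :
    steinAsympVar μ s2 M n
      = (∑ i, ∑ j, steinGrad a i * steinGrad a j * steinCov μ s2 M i j) / n := by
  have hB : a 3 - a 0 * a 1 = etaTwo μ M := by rw [h0, h1, h3, etaTwo]
  have hG : steinG a = (M 1 0 1 - M 1 1 0) / etaTwo μ M := by rw [steinG, hB, h2, h3]
  have key : ∑ i, ∑ j, steinGrad a i * steinGrad a j * steinCov μ s2 M i j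
      = (∑ i, ∑ j, (etaTwo μ M * steinNum a i) * (etaTwo μ M * steinNum a j)
        * steinCov μ s2 M i j) / etaTwo μ M ^ 4 := by
    simp only [Finset.sum_div, steinGrad, hB]
    refine Finset.sum_congr rfl fun i _ => Finset.sum_congr rfl fun j _ => ?_
    field_simp
  have hw : (fun i => etaTwo μ M * steinNum a i)
      = ![(M 1 0 1 - M 1 1 0) * M 0 0 1, (M 1 0 1 - M 1 1 0) * μ, -etaTwo μ M,
        etaTwo μ M - (M 1 0 1 - M 1 1 0)] := by
    funext i
    fin_cases i <;> simp [steinNum, hG, h0, h1] <;> field_simp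
  rw [key]
  simp only [fun i => congrFun hw i]
  rw [steinAsympVar, div_div, one_div, inv_mul_eq_div]
  congr 1
  simp only [Fin.sum_univ_four, steinCov, Matrix.cons_val, etaTwo]
  ring

/-- Same clearing of fractions; both parts of `steinQuad` share the denominator `η₂ ^ 3`. -/
theorem steinAsympBias_eq_sum {μ s2 : ℝ} {M : ℕ → ℕ → ℕ → ℝ} (hη : etaTwo μ M ≠ 0)
    {a : Fin 4 → ℝ} (h0 : a 0 = μ) (h1 : a 1 = M 0 0 1) (h2 : a 2 = M 1 1 0)
    (h3 : a 3 = M 1 0 1) (n : ℕ) :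
    steinAsympBias μ s2 M n = ∑ i, ∑ j, steinQuad a i j * (steinCov μ s2 M i j / n) := by
  have hB : a 3 - a 0 * a 1 = etaTwo μ M := by rw [h0, h1, h3, etaTwo]
  have hG : steinG a = (M 1 0 1 - M 1 1 0) / etaTwo μ M := by rw [steinG, hB, h2, h3]
  have hQ : ∀ i j, steinQuad a i j = (etaTwo μ M * (M 1 0 1 - M 1 1 0) *
      (![1, 0, 0, 0] i * ![0, 1, 0, 0] j)
      - ![(M 1 0 1 - M 1 1 0) * M 0 0 1, (M 1 0 1 - M 1 1 0) * μ, -etaTwo μ M,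
        etaTwo μ M - (M 1 0 1 - M 1 1 0)] i * ![-M 0 0 1, -μ, 0, 1] j) / etaTwo μ M ^ 3 := by
    intro i j
    have hw : steinNum a i = ![(M 1 0 1 - M 1 1 0) * M 0 0 1, (M 1 0 1 - M 1 1 0) * μ,
        -etaTwo μ M, etaTwo μ M - (M 1 0 1 - M 1 1 0)] i / etaTwo μ M := by
      fin_cases i <;> simp [steinNum, hG, h0, h1] <;> field_simp
    rw [steinQuad, hw, hB, hG, h0, h1]
    field_simp
  have key : ∀ i j, steinQuad a i j * (steinCov μ s2 M i j / n)
      = ((etaTwo μ M * (M 1 0 1 - M 1 1 0) *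
      (![1, 0, 0, 0] i * ![0, 1, 0, 0] j)
      - ![(M 1 0 1 - M 1 1 0) * M 0 0 1, (M 1 0 1 - M 1 1 0) * μ, -etaTwo μ M,
        etaTwo μ M - (M 1 0 1 - M 1 1 0)] i * ![-M 0 0 1, -μ, 0, 1] j) * steinCov μ s2 M i j)
        / (etaTwo μ M ^ 3 * n) := by
    intro i j
    rw [hQ, div_mul_div_comm]
  simp only [key, ← Finset.sum_div]
  rw [steinAsympBias, one_div, neg_mul, inv_mul_eq_div, ← neg_div]
  congr 1
  simp only [Fin.sum_univ_four, steinCov, Matrix.cons_val, etaTwo]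
  ring

/-! ### Consequences of the Stein identity and nondegeneracy. -/

/-- The Stein identity for `f = 1` reads `E[X] = q μ + (1 - q) E[X]`. -/
theorem integral_nbMeasure_id {μ q : ℝ} (hμ : 0 < μ) (hq : q ∈ Set.Ioo (0 : ℝ) 1) :
    ∫ x : ℕ, (x : ℝ) ∂nbMeasure (q * μ / (1 - q)) q = μ := by
  have hq' : 0 < 1 - q := by linarith [hq.2]
  have hν : 0 < q * μ / (1 - q) := div_pos (mul_pos hq.1 hμ) hq'
  have := isProbabilityMeasure_nbMeasure hν hq
  have hx : Integrable (fun x : ℕ => (x : ℝ)) (nbMeasure (q * μ / (1 - q)) q) :=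
    ((memLp_two_iff_integrable_sq Measurable.of_discrete.aestronglyMeasurable).2
      (integrable_sq_nbMeasure hν hq)).integrable (by norm_num)
  have h := stein_identity_nbMeasure (f := fun _ => 1) hν hq (by simpa using hx)
  simp only [mul_one] at h
  rw [integral_add (integrable_const _) hx, integral_const] at h
  simp only [probReal_univ, one_smul, mul_add, mul_div_cancel₀ _ hq'.ne'] at h
  have hq0 := hq.1.ne'
  apply mul_left_cancel₀ hq0
  linear_combination h

/-- The Stein identity in terms of mixed moments. -/
theorem mixedMoment_sub_eq {μ q : ℝ} (hμ : 0 < μ) (hq : q ∈ Set.Ioo (0 : ℝ) 1) {f : ℕ → ℝ}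
    {ρ : Measure ℕ} (hρ : ρ = nbMeasure (q * μ / (1 - q)) q)
    (h001 : Integrable (fun x : ℕ => f (x + 1)) ρ)
    (h110 : Integrable (fun x : ℕ => x * f x) ρ)
    (h101 : Integrable (fun x : ℕ => x * f (x + 1)) ρ) :
    mixedMoment ρ f 1 0 1 - mixedMoment ρ f 1 1 0 = q * etaTwo μ (mixedMoment ρ f) := by
  have hq' : 0 < 1 - q := by linarith [hq.2]
  have hν : 0 < q * μ / (1 - q) := div_pos (mul_pos hq.1 hμ) hq'
  subst hρ
  have h := stein_identity_nbMeasure hν hq h110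
  simp only [add_mul] at h
  rw [integral_add (h001.const_mul _) h101, integral_const_mul] at h
  simp only [etaTwo, mixedMoment, pow_one, pow_zero, mul_one, one_mul]
  field_simp at h
  linear_combination -h

/-- The linearized estimator is not degenerate. -/
theorem variance_steinGrad_ne_zero {μ q : ℝ} (hμ : 0 < μ) (hq : q ∈ Set.Ioo (0 : ℝ) 1)
    {f : ℕ → ℝ} {ρ : Measure ℕ} (hρ : ρ = nbMeasure (q * μ / (1 - q)) q)
    (hZ : ∀ j, MemLp (fun x => steinVec f x j) 2 ρ)
    (hη : etaTwo μ (mixedMoment ρ f) ≠ 0) {a : Fin 4 → ℝ}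
    (ha : ∀ j, a j = ∫ x, steinVec f x j ∂ρ) (hG : steinG a = q) :
    Var[fun x => ∑ j, steinGrad a j * steinVec f x j; ρ] ≠ 0 := by
  intro hv
  have hq' : 0 < 1 - q := by linarith [hq.2]
  have hν : 0 < q * μ / (1 - q) := div_pos (mul_pos hq.1 hμ) hq'
  have hprob : IsProbabilityMeasure ρ := hρ ▸ isProbabilityMeasure_nbMeasure hν hq
  obtain ⟨e0, e1, e2, e3⟩ := integral_steinVec f ρ
  have hm : ∫ x : ℕ, (x : ℝ) ∂ρ = μ := hρ ▸ integral_nbMeasure_id hμ hq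
  set M := mixedMoment ρ f
  have a0 : a 0 = μ := by rw [ha, e0, hm]
  have a1 : a 1 = M 0 0 1 := by rw [ha, e1]
  have a3 : a 3 = M 1 0 1 := by rw [ha, e3]
  have hB : a 3 - a 0 * a 1 = etaTwo μ M := by rw [a0, a1, a3, etaTwo]
  have hA : a 3 - a 2 = q * etaTwo μ M := by
    rw [← hG, steinG, hB, div_mul_cancel₀ _ hη]
  have hL : MemLp (fun x => ∑ j, steinGrad a j * steinVec f x j) 2 ρ :=
    memLp_finsetSum _ fun j _ => (hZ j).const_mul _
  have hae := ae_eq_integral_of_variance_eq_zero hL hv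
  have hE : ∫ x, ∑ j, steinGrad a j * steinVec f x j ∂ρ = ∑ j, steinGrad a j * a j := by
    rw [integral_finsetSum _ fun j _ => ((hZ j).integrable (by norm_num)).const_mul _]
    simp only [integral_const_mul, ha]
  rw [hE, hρ] at hae
  replace hae := (ae_nbMeasure_iff hν hq _).1 hae
  -- The linearized statistic equals its mean at every `x`, multiplied by `η₂`; the relation `a 3 -
  -- a 2 = q η₂` simplifies the constant.
  have hall : ∀ x : ℕ, (x * (1 - q) + q * μ) * f (x + 1) - x * f x + q * M 0 0 1 * x
      = q * μ * M 0 0 1 := by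
    intro x
    have h := hae x
    simp only [steinGrad, div_mul_eq_mul_div, ← Finset.sum_div] at h
    rw [div_left_inj' (hB ▸ hη)] at h
    simp only [Fin.sum_univ_four, steinNum, steinVec, Matrix.cons_val, hG, a0, a1] at h
    rw [etaTwo, ← a3] at hA
    linear_combination h + hA
  -- At `x = 0` the term `x * f x` drops out, which fixes `f 1` whatever `f 0` is; afterwards the
  -- recursion propagates the value, since the coefficient of `f (x + 1)` is positive.
  have hconst : ∀ x, f (x + 1) = M 0 0 1 := by
    intro x
    have hpos : 0 < x * (1 - q) + q * μ := by
      have := mul_pos hq.1 hμ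
      positivity
    apply mul_left_cancel₀ hpos.ne'
    induction x with
    | zero =>
      have := hall 0
      push_cast at this ⊢
      linear_combination this
    | succ x ih =>
      have hx : f (x + 1) = M 0 0 1 := by
        have hpos : 0 < x * (1 - q) + q * μ := by
          have := mul_pos hq.1 hμ
          positivity
        exact mul_left_cancel₀ hpos.ne' (ih hpos)
      have := hall (x + 1)
      rw [hx] at this
      linear_combination this
  apply hη
  have : M 1 0 1 = μ * M 0 0 1 := by
    change mixedMoment ρ f 1 0 1 = _
    simp only [mixedMoment, hconst, pow_one, pow_zero, mul_one]
    rw [integral_mul_const, hm]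
  rw [etaTwo, this, sub_self]

/-! ### The estimator as a function of sample means, and the theorem. -/

/-- Vanishing denominators need no separate case: both sides use the division with `x / 0 = 0`. -/
theorem steinEstimator_eq {Ω : Type*} (f : ℕ → ℝ) (X : ℕ → Ω → ℕ) (n : ℕ) (ω : Ω) :
    steinEstimator f X n ω = steinG fun j => sampleMean X (fun x => steinVec f x j) n ω := by
  have h : sampleMean X (fun x => x * (f (x + 1) - f x)) n ω
      = sampleMean X (fun x => x * f (x + 1)) n ω - sampleMean X (fun x => x * f x) n ω := by
    simp only [sampleMean, mul_sub, Finset.sum_sub_distrib, sub_div]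
  rw [steinEstimator, h]
  rfl

theorem mainTheorem3 {Ω : Type*} [MeasurableSpace Ω] (P : Measure Ω) [IsProbabilityMeasure P]
    (μ q : ℝ) (hμ : 0 < μ) (hq : q ∈ Set.Ioo (0 : ℝ) 1)
    (ρ : Measure ℕ) (hρ : ρ = nbMeasure (q * μ / (1 - q)) q)
    (X : ℕ → Ω → ℕ) (hX : ∀ i, Measurable (X i)) (hindep : iIndepFun X P)
    (hlaw : ∀ i, P.map (X i) = ρ)
    (f : ℕ → ℝ)
    (h002 : Integrable (fun x : ℕ => f (x + 1) ^ 2) ρ)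
    (h220 : Integrable (fun x : ℕ => (x : ℝ) ^ 2 * f x ^ 2) ρ)
    (h202 : Integrable (fun x : ℕ => (x : ℝ) ^ 2 * f (x + 1) ^ 2) ρ)
    (hη : etaTwo μ (mixedMoment ρ f) ≠ 0) :
    IsAsymptoticallyNormal P (steinEstimator f X) q
        (steinAsympVar μ (Var[fun x : ℕ => (x : ℝ); ρ]) (mixedMoment ρ f)) ∧
      IsAsymptoticBias P (steinEstimator f X) q steinG
        (fun n ω j => sampleMean X (fun x => steinVec f x j) n ω)
        (fun j => ∫ x, steinVec f x j ∂ρ)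
        (steinAsympBias μ (Var[fun x : ℕ => (x : ℝ); ρ]) (mixedMoment ρ f)) := by
  have hq' : 0 < 1 - q := by linarith [hq.2]
  have hν : 0 < q * μ / (1 - q) := div_pos (mul_pos hq.1 hμ) hq'
  have hprob : IsProbabilityMeasure ρ := hρ ▸ isProbabilityMeasure_nbMeasure hν hq
  have hZ := memLp_steinVec (hρ ▸ integrable_sq_nbMeasure hν hq) h002 h220 h202
  have hZi := fun j => (hZ j).integrable (by norm_num)
  have hm : ∫ x : ℕ, (x : ℝ) ∂ρ = μ := hρ ▸ integral_nbMeasure_id hμ hq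
  have hC := covariance_steinVec_eq_steinCov hZ
  rw [hm] at hC
  have hst := mixedMoment_sub_eq hμ hq hρ (hZi 1) (hZi 2) (hZi 3)
  set a : Fin 4 → ℝ := fun j => ∫ x, steinVec f x j ∂ρ with ha
  set M := mixedMoment ρ f
  set s2 := Var[fun x : ℕ => (x : ℝ); ρ]
  obtain ⟨a0, a1, a2, a3⟩ : a 0 = μ ∧ a 1 = M 0 0 1 ∧ a 2 = M 1 1 0 ∧ a 3 = M 1 0 1 := by
    obtain ⟨e0, e1, e2, e3⟩ := integral_steinVec f ρ
    exact ⟨e0.trans hm, e1, e2, e3⟩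
  have hB : a 3 - a 0 * a 1 = etaTwo μ M := by rw [a0, a1, a3, etaTwo]
  have hB0 : a 3 - a 0 * a 1 ≠ 0 := hB ▸ hη
  have hG : steinG a = q := by rw [steinG, hB, a2, a3, hst, mul_div_cancel_right₀ _ hη]
  have hW : ∀ n ω, (fun j => sampleMean X (fun x => steinVec f x j) n ω)
      = a + fun j => sampleMean X (fun x => steinVec f x j) n ω - ∫ x, steinVec f x j ∂ρ :=
    fun n ω => by funext j; simp [ha]
  have hWm : ∀ n j, Measurable (sampleMean X (fun x => steinVec f x j) n) :=
    fun n j => measurable_sampleMean hX _ n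
  refine ⟨?_, ?_, fun n hn => ?_⟩
  · set v := Var[fun x => ∑ j, steinGrad a j * steinVec f x j; ρ] with hv
    have hv0 : v ≠ 0 := variance_steinGrad_ne_zero hμ hq hρ hZ hη (fun _ => rfl) hG
    have hvpos : 0 < v := (variance_nonneg _ _).lt_of_ne' hv0
    have hvar : ∀ n, steinAsympVar μ s2 M n = v / n := fun n => by
      rw [steinAsympVar_eq_sum hη a0 a1 a2 a3, hv, variance_sum_mul hZ]
      simp only [hC]
    have hL : MemLp (fun x => ∑ j, steinGrad a j * steinVec f x j) 2 ρ :=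
      memLp_finsetSum _ fun j _ => (hZ j).const_mul _
    have hE : ∫ x, ∑ j, steinGrad a j * steinVec f x j ∂ρ = ∑ j, steinGrad a j * a j := by
      rw [integral_finsetSum _ fun j _ => (hZi j).const_mul _]
      simp only [integral_const_mul, ha]
    refine ⟨?_, ?_⟩
    · filter_upwards [eventually_gt_atTop 0] with n hn
      rw [hvar]
      positivity
    -- Slutsky: the standardized estimator differs from the standardized sample mean of the linear
    -- part by `√n / √v` times the first-order remainder.
    · refine tendstoInDistribution_of_tendstoInMeasure_sub _ _
        (tendstoInDistribution_sampleMean hX hindep hlaw hL hv0) ?_ fun n => ?_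
      · have h := tendstoInMeasure_sqrt_mul_of_isBigO hX hindep hlaw hZ
          ((steinG_linear_remainder_isBigO hB0).const_mul_left (√v)⁻¹)
        refine h.congr (fun n => ae_of_all _ fun ω => ?_) EventuallyEq.rfl
        simp only [Pi.sub_apply]
        rw [← hW, ← steinEstimator_eq, hG, hvar, Real.sqrt_div hvpos.le, hE, ← hv,
          sampleMean_sum_mul (Z := fun j x => steinVec f x j), div_div_eq_mul_div]
        simp only [mul_sub, Finset.sum_sub_distrib, ha]
        ring
      · refine Measurable.aemeasurable (Measurable.div_const (Measurable.sub_const ?_ _) _)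
        exact (measurable_sampleMean hX _ n).div
          ((measurable_sampleMean hX _ n).sub
            ((measurable_sampleMean hX _ n).mul (measurable_sampleMean hX _ n)))
  · have h := tendstoInMeasure_mul_of_isLittleO hX hindep hlaw hZ (steinG_taylor_isLittleO hB0)
    refine h.congr (fun n => ae_of_all _ fun ω => ?_) EventuallyEq.rfl
    simp only
    rw [← hW, ← steinEstimator_eq, hG]
    rfl
  · simp only [taylorTwo_steinG_eq_sum hB0]
    have hh : ∀ ω j, ((fun j => sampleMean X (fun x => steinVec f x j) n ω) - a) j
      = sampleMean X (fun x => steinVec f x j) n ω - ∫ x, steinVec f x j ∂ρ := fun _ _ => rfl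
    obtain ⟨i1, i2⟩ := integrable_quadratic_sampleMean hX hlaw hZ (steinGrad a) (steinQuad a) n hh
    refine ⟨i1.add i2, ?_⟩
    rw [integral_quadratic_sampleMean hX hindep hlaw hZ (steinGrad a) (steinQuad a) hn hh,
      steinAsympBias_eq_sum hη a0 a1 a2 a3]
    simp only [hC]
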